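/- Let $\mu$ be a nontrivial probability measure on the unit circle $\mathbb{T}$ (a Borel probability measure with infinite support). Let $\phi_n$ be its monic orthogonal polynomials ($\phi_n$ monic of degree $n$ with $\int_{\mathbb T}\bar z^{\,j}\phi_n(z)\,d\mu(z)=0$ for $0\le j\le n-1$), let $\alpha_{n-1}=-\overline{\phi_n(0)}$, $n\ge1$, be its Verblunsky coefficients, and let $\tau_0=1$ and $$\tau_n=\tau_{n-1}\,\frac{1-\overline{\tau}_{n-1}\overline{\alpha}_{n-1}}{1-\tau_{n-1}\alpha_{n-1}},\qquad n\ge1 .$$ The pair of real sequences $\{\{c_n\}_{n\ge1},\{d_n\}_{n\ge1}\}$ associated with $\mu$ is given by $$c_n=\frac{-\operatorname{Im}(\tau_{n-1}\alpha_{n-1})}{1-\operatorname{Re}(\tau_{n-1}\alpha_{n-1})},\qquad m_0=0,\quad m_n=\frac12\,\frac{|1-\tau_{n-1}\alpha_{n-1}|^2}{1-\operatorname{Re}(\tau_{n-1}\alpha_{n-1})},\qquad d_n=(1-m_{n-1})m_n,\qquad n\ge1;$$ here $\{d_n\}$ is a positive chain sequence and $\{m_n\}_{n\ge0}$ is its minimal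 parameter sequence (that is, $m_0=0$ and $0<m_n<1$ for $n\ge1$). Suppose that $c_n=(-1)^n c$ for all $n\ge1$, where $c\in\mathbb{R}$. Let $\beta=-\left(\frac{1+ic}{1-ic}\right)\in\mathbb{T}$, and let $\tilde\mu(z)=\mu(\beta z)$ be the rotated measure, i.e. $\tilde\mu(E)=\mu(\beta E)$ for every Borel set $E\subseteq\mathbb{T}$. Then $\tilde\mu$ is again a nontrivial probability measure, it has an associated pair $\{\{\tilde c_n\}_{n\ge1},\{\tilde d_n\}_{n\ge1}\}$, and for every such pair $\tilde c_n=c$ for all $n\ge1$. -/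

import Mathlib

open MeasureTheory Polynomial
open scoped ComplexConjugate

noncomputable section

/-- The unit circle carries its Borel sigma-algebra. -/
instance instMeasurableSpaceCircle : MeasurableSpace Circle := borel Circle

instance instBorelSpaceCircle : BorelSpace Circle := ⟨rfl⟩

/-- A measure on the unit circle is nontrivial if its support is an infinite set. -/
def IsNontrivialMeasure (μ : Measure Circle) : Prop :=
  μ.support.Infinite

/-- `φ` is the sequence of monic orthogonal polynomials on the unit circle (OPUC) of `μ`:
`φ n` is monic of degree `n` and `∫ z̄ ^ j * φ n z dμ(z) = 0` for `0 ≤ j ≤ n - 1`. -/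
structure IsMonicOPUC (μ : Measure Circle) (φ : ℕ → ℂ[X]) : Prop where
  monic : ∀ n, (φ n).Monic
  natDegree_eq : ∀ n, (φ n).natDegree = n
  orthogonal : ∀ n j, j < n →
    ∫ z : Circle, (conj (z : ℂ)) ^ j * (φ n).eval (z : ℂ) ∂μ = 0

/-- `α` is the sequence of Verblunsky coefficients of `μ`: `α (n - 1) = - conj (φ n 0)` for
`n ≥ 1`, where `φ` is the sequence of monic OPUC of `μ`. -/
def IsVerblunskySequence (μ : Measure Circle) (α : ℕ → ℂ) : Prop :=
  ∃ φ : ℕ → ℂ[X], IsMonicOPUC μ φ ∧ ∀ n, α n = -conj ((φ (n + 1)).eval 0)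

/-- The unimodular numbers `τ n` attached to the Verblunsky coefficients: `τ 0 = 1` and
`τ n = τ (n - 1) * (1 - conj (τ (n - 1)) * conj (α (n - 1))) / (1 - τ (n - 1) * α (n - 1))`. -/
def tau (α : ℕ → ℂ) : ℕ → ℂ
  | 0 => 1
  | n + 1 => tau α n * ((1 - conj (tau α n) * conj (α n)) / (1 - tau α n * α n))

/-- `g = (g 0, g 1, …)` is a parameter sequence of `d = (d 1, d 2, …)`, as a positive chain
sequence: `0 ≤ g 0 < 1`, `0 < g n < 1` and `d n = (1 - g (n - 1)) * g n` for `n ≥ 1`.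
The value `d 0` plays no role. -/
structure IsParameterSequence (d g : ℕ → ℝ) : Prop where
  zero_nonneg : 0 ≤ g 0
  zero_lt_one : g 0 < 1
  pos : ∀ n, 0 < g (n + 1)
  lt_one : ∀ n, g (n + 1) < 1
  eq : ∀ n, d (n + 1) = (1 - g n) * g (n + 1)

/-- `(d 1, d 2, …)` is a positive chain sequence. -/
def IsPositiveChainSequence (d : ℕ → ℝ) : Prop :=
  ∃ g : ℕ → ℝ, IsParameterSequence d g

/-- The minimal parameter sequence of a positive chain sequence is the one that starts
with `m 0 = 0`. -/
def IsMinimalParameterSequence (d m : ℕ → ℝ) : Prop :=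
  IsParameterSequence d m ∧ m 0 = 0

/-- `(c 1, c 2, …)`, `(d 1, d 2, …)` is the pair of real sequences associated with `μ`:
`d` is a positive chain sequence and, if `α` are the Verblunsky coefficients of `μ`, `τ` the
numbers above and `m` the minimal parameter sequence of `d`, then for `n ≥ 1`
`c n = - Im (τ (n - 1) * α (n - 1)) / (1 - Re (τ (n - 1) * α (n - 1)))` and
`m n = |1 - τ (n - 1) * α (n - 1)| ^ 2 / (2 * (1 - Re (τ (n - 1) * α (n - 1))))`.
The values `c 0` and `d 0` play no role. -/
def IsAssociatedPair (μ : Measure Circle) (c d : ℕ → ℝ) : Prop :=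
  IsPositiveChainSequence d ∧
  ∃ (α : ℕ → ℂ) (m : ℕ → ℝ),
    IsVerblunskySequence μ α ∧
    IsMinimalParameterSequence d m ∧
    (∀ n, c (n + 1) = -(tau α n * α n).im / (1 - (tau α n * α n).re)) ∧
    (∀ n, m (n + 1) = (1 / 2) * (‖1 - tau α n * α n‖ ^ 2 / (1 - (tau α n * α n).re)))

/-- The rotated measure `μ̃(z) = μ(β z)`, see `rotatedMeasure_apply`. -/
def rotatedMeasure (β : Circle) (μ : Measure Circle) : Measure Circle :=
  μ.map (fun z => β⁻¹ * z)

/-- The rotated measure gives to a set `E` the mass `μ (β E)`. -/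
theorem rotatedMeasure_apply (β : Circle) (μ : Measure Circle) (E : Set Circle) :
    rotatedMeasure β μ E = μ ((fun z => β * z) '' E) := by
  have h : rotatedMeasure β μ = μ.map (MeasurableEquiv.mulLeft β⁻¹) := rfl
  rw [h, MeasurableEquiv.map_apply]
  congr 1
  ext z
  simp only [Set.mem_preimage, Set.mem_image, MeasurableEquiv.coe_mulLeft]
  constructor
  · intro hz
    exact ⟨_, hz, by simp⟩
  · rintro ⟨w, hw, rfl⟩
    simpa using hw

end

/-! Rotation multiplies `α n` by `β ^ (n + 1)`, so the claim reduces to algebra with `τ`. If `1 - τ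
α = s (1 + i t)` with `s ≠ 0` real, then `t` is the corresponding `c`-value and `τ` is next
multiplied by `(1 - i t) / (1 + i t)`. Alternating values therefore make `τ` oscillate between `1`
and `-β` (`tau_of_alternating`), while the rotated sequence should have `τ̃ n = (-β⁻¹) ^ n`, hence
`τ̃ α̃ = (-1) ^ n β α n`. `one_sub_tau_mul_rotated` checks by induction that `1 - τ̃ α̃` always lies
on the real line spanned by `1 + i c`. Uniqueness of the Verblunsky coefficients, from infinite
support, extends this to every associated pair. -/

/-! ### Orthogonal polynomials: uniqueness and rotation. -/

theorem isNontrivialMeasure_rotatedMeasure {μ : Measure Circle} (hμ : IsNontrivialMeasure μ)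
    (β : Circle) : IsNontrivialMeasure (rotatedMeasure β μ) := by
  have hsub : (fun z => β⁻¹ * z) '' μ.support ⊆ (rotatedMeasure β μ).support := by
    rintro _ ⟨z, hz, rfl⟩
    rw [Measure.mem_support_iff_forall] at hz ⊢
    intro U hU
    have hc : Continuous fun w : Circle => β⁻¹ * w := by fun_prop
    have h := hz _ (hc.continuousAt.preimage_mem_nhds hU)
    refine h.trans_le ?_
    exact Measure.le_map_apply hc.aemeasurable U
  exact (hμ.image (mul_right_injective β⁻¹).injOn).mono hsub

theorem integrable_of_continuous_circle {μ : Measure Circle} [IsFiniteMeasure μ] {f : Circle → ℂ}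
    (hf : Continuous f) : Integrable f μ :=
  hf.integrable_of_hasCompactSupport (HasCompactSupport.of_compactSpace f)

/-- Such a `p` is orthogonal to itself, so `∫ |p|² = 0`; by continuity a nonzero value at a support
point would give positive mass. -/
theorem eval_eq_zero_of_mem_support {μ : Measure Circle} [IsFiniteMeasure μ] {p : ℂ[X]} {n : ℕ}
    (hdeg : p.natDegree < n)
    (horth : ∀ j < n, ∫ z : Circle, (conj (z : ℂ)) ^ j * p.eval (z : ℂ) ∂μ = 0)
    {z : Circle} (hz : z ∈ μ.support) : p.eval (z : ℂ) = 0 := by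
  have hint : ∫ z : Circle, conj (p.eval (z : ℂ)) * p.eval (z : ℂ) ∂μ = 0 := by
    have hexp : ∀ z : Circle, conj (p.eval (z : ℂ)) * p.eval (z : ℂ) =
        ∑ j ∈ Finset.range n, conj (p.coeff j) * ((conj (z : ℂ)) ^ j * p.eval (z : ℂ)) := by
      intro z
      conv_lhs => rw [eval_eq_sum_range' hdeg (z : ℂ), map_sum, ← eval_eq_sum_range' hdeg (z : ℂ)]
      rw [Finset.sum_mul]
      refine Finset.sum_congr rfl fun j _ => ?_
      rw [map_mul, map_pow, mul_assoc]
    simp_rw [hexp]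
    rw [integral_finsetSum]
    · refine Finset.sum_eq_zero fun j hj => ?_
      rw [integral_const_mul, horth j (Finset.mem_range.1 hj), mul_zero]
    · intro j _
      exact integrable_of_continuous_circle (by fun_prop)
  have hreal : ∫ z : Circle, ‖p.eval (z : ℂ)‖ ^ 2 ∂μ = 0 := by
    have h : ∀ z : Circle, conj (p.eval (z : ℂ)) * p.eval (z : ℂ) =
        ((‖p.eval (z : ℂ)‖ ^ 2 : ℝ) : ℂ) := by
      intro z
      rw [mul_comm, Complex.mul_conj, Complex.normSq_eq_norm_sq]
    have hcongr := integral_congr_ae (μ := μ) (Filter.Eventually.of_forall h)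
    have hofReal := integral_ofReal (μ := μ) (𝕜 := ℂ) (f := fun z : Circle => ‖p.eval (z : ℂ)‖ ^ 2)
    exact Complex.ofReal_eq_zero.1 (hofReal.symm.trans (hcongr.symm.trans hint))
  have hcont : Continuous fun z : Circle => ‖p.eval (z : ℂ)‖ ^ 2 := by fun_prop
  have hae := (integral_eq_zero_iff_of_nonneg (fun z => by positivity)
    (hcont.integrable_of_hasCompactSupport (HasCompactSupport.of_compactSpace _))).1 hreal
  by_contra hne
  have hopen : {w : Circle | ‖p.eval (w : ℂ)‖ ^ 2 ≠ 0} ∈ nhds z :=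
    (isOpen_ne_fun hcont continuous_const).mem_nhds (by simpa using hne)
  have hpos := (Measure.mem_support_iff_forall z).1 hz _ hopen
  exact hpos.ne' hae

theorem IsMonicOPUC.unique {μ : Measure Circle} [IsFiniteMeasure μ] (hμ : IsNontrivialMeasure μ)
    {φ ψ : ℕ → ℂ[X]} (hφ : IsMonicOPUC μ φ) (hψ : IsMonicOPUC μ ψ) : φ = ψ := by
  funext n
  rcases Nat.eq_zero_or_pos n with rfl | hn
  · rw [(hφ.monic 0).natDegree_eq_zero.1 (hφ.natDegree_eq 0),
      (hψ.monic 0).natDegree_eq_zero.1 (hψ.natDegree_eq 0)]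
  by_contra hne
  have hsub : φ n - ψ n ≠ 0 := sub_ne_zero.2 hne
  have hdeg : (φ n - ψ n).natDegree < n := by
    rw [natDegree_lt_iff_degree_lt hsub]
    have h := degree_sub_lt_left (p := φ n) (q := ψ n)
      (by rw [degree_eq_natDegree (hφ.monic n).ne_zero, degree_eq_natDegree (hψ.monic n).ne_zero,
        hφ.natDegree_eq, hψ.natDegree_eq]) (hφ.monic n).ne_zero
      (by rw [(hφ.monic n).leadingCoeff, (hψ.monic n).leadingCoeff])
    rwa [degree_eq_natDegree (hφ.monic n).ne_zero, hφ.natDegree_eq] at h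
  have horth : ∀ j < n, ∫ z : Circle, (conj (z : ℂ)) ^ j * (φ n - ψ n).eval (z : ℂ) ∂μ = 0 := by
    intro j hj
    simp_rw [eval_sub, mul_sub]
    rw [integral_sub (integrable_of_continuous_circle (by fun_prop))
      (integrable_of_continuous_circle (by fun_prop)), hφ.orthogonal n j hj,
      hψ.orthogonal n j hj, sub_zero]
  refine (hμ.image (Subtype.val_injective (p := fun z => z ∈ Submonoid.unitSphere ℂ)).injOn) ?_
  refine (φ n - ψ n).rootSet_finite ℂ |>.subset ?_
  rintro _ ⟨z, hz, rfl⟩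
  rw [mem_rootSet]
  exact ⟨hsub, by simpa using eval_eq_zero_of_mem_support hdeg horth hz⟩

theorem IsVerblunskySequence.unique {μ : Measure Circle} [IsFiniteMeasure μ]
    (hμ : IsNontrivialMeasure μ) {α γ : ℕ → ℂ} (hα : IsVerblunskySequence μ α)
    (hγ : IsVerblunskySequence μ γ) : α = γ := by
  obtain ⟨φ, hφ, hα⟩ := hα
  obtain ⟨ψ, hψ, hγ⟩ := hγ
  obtain rfl := hφ.unique hμ hψ
  funext n
  rw [hα, hγ]

/-- Scaling the roots by `β⁻¹` gives `β⁻¹ ^ n * φ n (β z)`, which stays monic. -/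
theorem IsMonicOPUC.rotatedMeasure {μ : Measure Circle} {φ : ℕ → ℂ[X]} (hφ : IsMonicOPUC μ φ)
    (β : Circle) :
    IsMonicOPUC (rotatedMeasure β μ) fun n => (φ n).scaleRoots ((β⁻¹ : Circle) : ℂ) where
  monic n := (monic_scaleRoots_iff _).2 (hφ.monic n)
  natDegree_eq n := by rw [natDegree_scaleRoots, hφ.natDegree_eq]
  orthogonal n j hj := by
    have hc : Continuous fun w : Circle => β⁻¹ * w := by fun_prop
    have hm : Continuous fun z : Circle => (conj (z : ℂ)) ^ j *
        ((φ n).scaleRoots ((β⁻¹ : Circle) : ℂ)).eval (z : ℂ) := by fun_prop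
    rw [_root_.rotatedMeasure, integral_map hc.aemeasurable hm.aestronglyMeasurable]
    have h : ∀ z : Circle, (conj ((β⁻¹ * z : Circle) : ℂ)) ^ j *
        ((φ n).scaleRoots ((β⁻¹ : Circle) : ℂ)).eval ((β⁻¹ * z : Circle) : ℂ) =
        (conj ((β⁻¹ : Circle) : ℂ) ^ j * ((β⁻¹ : Circle) : ℂ) ^ n) *
          ((conj (z : ℂ)) ^ j * (φ n).eval (z : ℂ)) := by
      intro z
      have := scaleRoots_eval₂_mul (p := φ n) (RingHom.id ℂ) (z : ℂ) ((β⁻¹ : Circle) : ℂ)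
      simp only [eval₂_id, RingHom.id_apply, hφ.natDegree_eq] at this
      rw [Circle.coe_mul, this, map_mul, mul_pow]
      ring
    simp_rw [h]
    rw [integral_const_mul, hφ.orthogonal n j hj, mul_zero]

theorem IsVerblunskySequence.rotatedMeasure {μ : Measure Circle} {α : ℕ → ℂ}
    (hα : IsVerblunskySequence μ α) (β : Circle) :
    IsVerblunskySequence (rotatedMeasure β μ) fun n => (β : ℂ) ^ (n + 1) * α n := by
  obtain ⟨φ, hφ, hα⟩ := hα
  refine ⟨_, hφ.rotatedMeasure β, fun n => ?_⟩
  rw [← coeff_zero_eq_eval_zero, coeff_scaleRoots, hφ.natDegree_eq, Nat.sub_zero, map_mul, map_pow,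
    ← Circle.coe_inv_eq_conj, inv_inv, coeff_zero_eq_eval_zero]
  show (β : ℂ) ^ (n + 1) * α n = _
  rw [hα]
  ring

/-! ### Algebra of `τ` and of the associated pair. -/

theorem one_sub_eq_mul_of_re_lt_one {a : ℂ} {t : ℝ} (ha : a.re < 1)
    (ht : t = -a.im / (1 - a.re)) :
    1 - a = ((1 - a.re : ℝ) : ℂ) * (1 + Complex.I * t) := by
  have h : (1 - a.re) * t = -a.im := by
    rw [ht]; field_simp [(sub_pos.2 ha).ne']
  apply Complex.ext
  · simp
  · simp [← h]

theorem one_add_I_mul_ne_zero (t : ℝ) : 1 + Complex.I * (t : ℂ) ≠ 0 := fun h => by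
  simpa using congrArg Complex.re h

theorem one_sub_I_mul_ne_zero (t : ℝ) : 1 - Complex.I * (t : ℂ) ≠ 0 := fun h => by
  simpa using congrArg Complex.re h

theorem neg_im_div_one_sub_re {a : ℂ} {s t : ℝ} (hs : s ≠ 0)
    (h : 1 - a = (s : ℂ) * (1 + Complex.I * t)) : -a.im / (1 - a.re) = t := by
  have hre := congrArg Complex.re h
  have him := congrArg Complex.im h
  simp at hre him
  rw [hre, him]
  field_simp

theorem one_sub_conj_div_one_sub {a : ℂ} {s t : ℝ} (hs : s ≠ 0)
    (h : 1 - a = (s : ℂ) * (1 + Complex.I * t)) :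
    (1 - conj a) / (1 - a) = (1 - Complex.I * t) / (1 + Complex.I * t) := by
  have h' : 1 - conj a = (s : ℂ) * (1 - Complex.I * t) := by
    have := congrArg conj h
    simpa [sub_eq_add_neg] using this
  rw [h, h', mul_div_mul_left _ _ (Complex.ofReal_ne_zero.2 hs)]

theorem tau_succ_of_one_sub_eq {α : ℕ → ℂ} {n : ℕ} {s t : ℝ} (hs : s ≠ 0)
    (h : 1 - tau α n * α n = (s : ℂ) * (1 + Complex.I * t)) :
    tau α (n + 1) = tau α n * ((1 - Complex.I * t) / (1 + Complex.I * t)) := by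
  rw [tau, ← map_mul, one_sub_conj_div_one_sub hs h]

theorem norm_one_sub_sq (a : ℂ) : ‖1 - a‖ ^ 2 = 2 * (1 - a.re) - (1 - ‖a‖ ^ 2) := by
  rw [← Complex.normSq_eq_norm_sq, ← Complex.normSq_eq_norm_sq, Complex.normSq_apply,
    Complex.normSq_apply]
  simp
  ring

/-- Positivity fixes the sign of the denominator; the upper bound then becomes `‖a‖ < 1` through
`norm_one_sub_sq`. -/
theorem re_lt_one_and_norm_lt_one {a : ℂ}
    (h0 : 0 < (1 / 2) * (‖1 - a‖ ^ 2 / (1 - a.re)))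
    (h1 : (1 / 2) * (‖1 - a‖ ^ 2 / (1 - a.re)) < 1) : a.re < 1 ∧ ‖a‖ < 1 := by
  have hre : 0 < 1 - a.re := by
    by_contra h
    have := div_nonpos_of_nonneg_of_nonpos (sq_nonneg ‖1 - a‖) (not_lt.1 h)
    linarith
  refine ⟨by linarith, ?_⟩
  have h2 : ‖1 - a‖ ^ 2 / (1 - a.re) < 2 := by linarith
  rw [div_lt_iff₀ hre, norm_one_sub_sq] at h2
  exact (sq_lt_one_iff₀ (norm_nonneg a)).1 (by linarith)

theorem parameter_mem_Ioo {a : ℂ} (ha : ‖a‖ < 1) :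
    (1 / 2) * (‖1 - a‖ ^ 2 / (1 - a.re)) ∈ Set.Ioo (0 : ℝ) 1 := by
  have hre : 0 < 1 - a.re := sub_pos.2 ((Complex.re_le_norm a).trans_lt ha)
  have hne : 1 - a ≠ 0 := fun h => hre.ne' (by simpa using congrArg Complex.re h)
  constructor
  · have := norm_pos_iff.2 hne
    positivity
  · have h2 : ‖1 - a‖ ^ 2 / (1 - a.re) < 2 := by
      rw [div_lt_iff₀ hre, norm_one_sub_sq]
      have := (sq_lt_one_iff₀ (norm_nonneg a)).2 ha
      linarith
    linarith

theorem norm_tau {α : ℕ → ℂ} (h : ∀ n, 1 - tau α n * α n ≠ 0) (n : ℕ) : ‖tau α n‖ = 1 := by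
  induction n with
  | zero => simp [tau]
  | succ n ih =>
    have hn : ‖1 - conj (tau α n) * conj (α n)‖ = ‖1 - tau α n * α n‖ := by
      rw [← Complex.norm_conj (1 - tau α n * α n)]
      simp
    rw [tau, norm_mul, norm_div, ih, hn, div_self (norm_ne_zero_iff.2 (h n)), one_mul]

/-- A measure whose Verblunsky coefficients lie in the unit disc has an associated pair. -/
theorem exists_isAssociatedPair {μ : Measure Circle} {α : ℕ → ℂ} (hα : IsVerblunskySequence μ α)
    (hlt : ∀ n, ‖α n‖ < 1) (hne : ∀ n, 1 - tau α n * α n ≠ 0) :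
    ∃ c d : ℕ → ℝ, IsAssociatedPair μ c d := by
  have hnorm : ∀ n, ‖tau α n * α n‖ < 1 := fun n => by
    rw [norm_mul, norm_tau hne, one_mul]
    exact hlt n
  let m : ℕ → ℝ := fun n => Nat.casesOn n 0 fun k =>
    (1 / 2) * (‖1 - tau α k * α k‖ ^ 2 / (1 - (tau α k * α k).re))
  have hm : IsParameterSequence (fun n => (1 - m (n - 1)) * m n) m :=
    { zero_nonneg := le_rfl
      zero_lt_one := zero_lt_one
      pos := fun n => (parameter_mem_Ioo (hnorm n)).1
      lt_one := fun n => (parameter_mem_Ioo (hnorm n)).2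
      eq := fun n => rfl }
  exact ⟨fun n => -(tau α (n - 1) * α (n - 1)).im / (1 - (tau α (n - 1) * α (n - 1)).re), _,
    ⟨m, hm⟩, α, m, hα, ⟨hm, rfl⟩, fun n => rfl, fun n => rfl⟩

theorem tau_of_alternating {α : ℕ → ℂ} {c : ℝ} (hre : ∀ n, (tau α n * α n).re < 1)
    (hc : ∀ n : ℕ, -(tau α n * α n).im / (1 - (tau α n * α n).re) = (-1) ^ (n + 1) * c) (k : ℕ) :
    tau α (2 * k) = 1 ∧
      tau α (2 * k + 1) = (1 + Complex.I * c) / (1 - Complex.I * c) := by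
  have step : ∀ n, tau α (n + 1) = tau α n *
      ((1 - Complex.I * (((-1) ^ (n + 1) * c : ℝ) : ℂ)) /
        (1 + Complex.I * (((-1) ^ (n + 1) * c : ℝ) : ℂ))) := fun n =>
    tau_succ_of_one_sub_eq (sub_pos.2 (hre n)).ne' (one_sub_eq_mul_of_re_lt_one (hre n) (hc n).symm)
  have heven : ∀ k, tau α (2 * k) = 1 → tau α (2 * k + 1) =
      (1 + Complex.I * c) / (1 - Complex.I * c) := by
    intro k hk
    rw [step, hk]
    simp [pow_succ, sub_eq_add_neg]
  induction k with
  | zero => exact ⟨rfl, heven 0 rfl⟩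
  | succ k ih =>
    have h : tau α (2 * (k + 1)) = 1 := by
      rw [show 2 * (k + 1) = 2 * k + 1 + 1 by ring, step, ih.2]
      have h1 := one_add_I_mul_ne_zero c
      have h2 := one_sub_I_mul_ne_zero c
      simp only [pow_succ, pow_mul]
      push_cast
      norm_num
      field_simp
    exact ⟨h, heven _ h⟩

/-- If the sequence of `α` is `(-1) ^ n * c`, then the sequence of the rotated coefficients
`b ^ (n + 1) * α n` is constantly `c`. -/
theorem one_sub_tau_mul_rotated {α : ℕ → ℂ} {c : ℝ} {b : ℂ}
    (hb : b = -((1 + Complex.I * (c : ℂ)) / (1 - Complex.I * (c : ℂ))))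
    (hlt : ∀ n, ‖tau α n * α n‖ < 1)
    (hc : ∀ n : ℕ, -(tau α n * α n).im / (1 - (tau α n * α n).re) = (-1) ^ (n + 1) * c) (n : ℕ) :
    ∃ s : ℝ, s ≠ 0 ∧
      1 - tau (fun n => b ^ (n + 1) * α n) n * (b ^ (n + 1) * α n) =
        (s : ℂ) * (1 + Complex.I * c) := by
  have h1 := one_add_I_mul_ne_zero c
  have h2 := one_sub_I_mul_ne_zero c
  have hb0 : b ≠ 0 := by
    rw [hb]
    exact neg_ne_zero.2 (div_ne_zero h1 h2)
  have hbinv : (1 - Complex.I * (c : ℂ)) / (1 + Complex.I * (c : ℂ)) = -b⁻¹ := by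
    rw [hb, inv_neg, inv_div, neg_neg]
  have hre : ∀ n, (tau α n * α n).re < 1 := fun n => (Complex.re_le_norm _).trans_lt (hlt n)
  have hτ := tau_of_alternating hre hc
  have key : ∀ n, tau (fun n => b ^ (n + 1) * α n) n = (-b⁻¹) ^ n → ∃ s : ℝ, s ≠ 0 ∧
      1 - tau (fun n => b ^ (n + 1) * α n) n * (b ^ (n + 1) * α n) =
        (s : ℂ) * (1 + Complex.I * c) := by
    intro n hn
    have hval : tau (fun n => b ^ (n + 1) * α n) n * (b ^ (n + 1) * α n) =
        (-1) ^ n * (b * α n) := by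
      rw [hn, neg_pow, pow_succ, inv_pow]
      field_simp
    have hfac := one_sub_eq_mul_of_re_lt_one (hre n) (hc n).symm
    have hpos : 0 < 1 - (tau α n * α n).re := sub_pos.2 (hre n)
    rw [hval]
    generalize 1 - (tau α n * α n).re = s at hfac hpos
    obtain ⟨k, rfl | rfl⟩ := n.even_or_odd'
    · have hnorm := hlt (2 * k)
      rw [(hτ k).1, one_mul] at hfac hnorm
      have hα : α (2 * k) = 1 - s * (1 - Complex.I * c) := by
        have h : 1 - α (2 * k) = s * (1 - Complex.I * c) := by
          rw [hfac]
          simp [pow_succ, sub_eq_add_neg]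
        rw [← h]
        ring
      -- `|α| < 1` gives `s² (1 + c²) = |1 - α|² < 2 s`; cancel `s > 0`.
      have hs : s * (1 + c ^ 2) < 2 := by
        have h4 := norm_one_sub_sq (α (2 * k))
        have h5 := (sq_lt_one_iff₀ (norm_nonneg _)).2 hnorm
        have h6 : 1 - α (2 * k) = ⟨s, -(s * c)⟩ := by
          rw [hα]
          apply Complex.ext <;> simp
        have h7 : (α (2 * k)).re = 1 - s := by
          rw [hα]
          simp
        rw [h6, ← Complex.normSq_eq_norm_sq, Complex.normSq_mk, h7] at h4
        refine lt_of_mul_lt_mul_left ?_ hpos.le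
        linarith
      have hc2 : 0 < 1 + c ^ 2 := by positivity
      -- The witness comes from `1 - b α = 2 / (1 - i c) - s (1 + i c)`.
      refine ⟨2 / (1 + c ^ 2) - s, (sub_pos.2 ((lt_div_iff₀ hc2).2 hs)).ne', ?_⟩
      have h3 : (1 : ℂ) + (c : ℂ) ^ 2 = (1 + Complex.I * c) * (1 - Complex.I * c) := by
        ring_nf
        simp
      rw [hα, hb, pow_mul]
      push_cast
      rw [h3]
      field_simp
      ring
    -- At odd indices `τ = -b`, so the rotated product equals the original one and `s` is unchanged.
    · rw [(hτ k).2] at hfac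
      refine ⟨s, hpos.ne', ?_⟩
      have h : ((-1 : ℂ)) ^ (2 * k + 1) * (b * α (2 * k + 1)) =
          (1 + Complex.I * c) / (1 - Complex.I * c) * α (2 * k + 1) := by
        rw [hb, pow_succ, pow_mul]
        ring_nf
      rw [h, hfac]
      simp [pow_succ]
  refine key n ?_
  induction n with
  | zero => rfl
  | succ n ih =>
    obtain ⟨s, hs, h⟩ := key n ih
    rw [tau_succ_of_one_sub_eq hs h, ih, hbinv, pow_succ]

theorem mainTheorem8 (μ : Measure Circle) [IsProbabilityMeasure μ]
    (hμ : IsNontrivialMeasure μ) (c : ℝ) (cseq d : ℕ → ℝ)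
    (hpair : IsAssociatedPair μ cseq d)
    (hc : ∀ n : ℕ, 1 ≤ n → cseq n = (-1) ^ n * c)
    (β : Circle)
    (hβ : (β : ℂ) = -((1 + Complex.I * (c : ℂ)) / (1 - Complex.I * (c : ℂ)))) :
    IsProbabilityMeasure (rotatedMeasure β μ) ∧
    IsNontrivialMeasure (rotatedMeasure β μ) ∧
    (∃ ctilde dtilde : ℕ → ℝ, IsAssociatedPair (rotatedMeasure β μ) ctilde dtilde) ∧
    ∀ ctilde dtilde : ℕ → ℝ, IsAssociatedPair (rotatedMeasure β μ) ctilde dtilde →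
      ∀ n : ℕ, 1 ≤ n → ctilde n = c := by
  obtain ⟨-, α, m, hα, ⟨hm, -⟩, hcα, hmα⟩ := hpair
  have hprob : IsProbabilityMeasure (rotatedMeasure β μ) :=
    Measure.isProbabilityMeasure_map (by fun_prop : Continuous fun z : Circle => β⁻¹ * z).aemeasurable
  have hnt := isNontrivialMeasure_rotatedMeasure hμ β
  have hlt : ∀ n, (tau α n * α n).re < 1 ∧ ‖tau α n * α n‖ < 1 := fun n =>
    re_lt_one_and_norm_lt_one (hmα n ▸ hm.pos n) (hmα n ▸ hm.lt_one n)
  have hnorm : ∀ n, ‖α n‖ < 1 := by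
    intro n
    have h := (hlt n).2
    rwa [norm_mul, norm_tau (fun k hk => ?_), one_mul] at h
    have := (hlt k).1
    rw [← sub_eq_zero.1 hk] at this
    simp at this
  have hrot := one_sub_tau_mul_rotated hβ (fun n => (hlt n).2)
    fun n => (hcα n).symm.trans (hc (n + 1) n.succ_pos)
  have hαrot := hα.rotatedMeasure β
  refine ⟨hprob, hnt, exists_isAssociatedPair hαrot (fun n => ?_) (fun n => ?_), ?_⟩
  · simpa [norm_mul, norm_pow, Circle.norm_coe] using hnorm n
  · obtain ⟨s, hs, h⟩ := hrot n
    rw [h]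
    exact mul_ne_zero (Complex.ofReal_ne_zero.2 hs) (one_add_I_mul_ne_zero c)
  · rintro ctilde dtilde ⟨-, γ, -, hγ, -, hcγ, -⟩ n hn
    obtain ⟨k, rfl⟩ := Nat.exists_eq_add_of_le' hn
    obtain rfl := hγ.unique hnt hαrot
    obtain ⟨s, hs, h⟩ := hrot k
    rw [hcγ]
    exact neg_im_div_one_sub_re hs h
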